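/- Let $A$ be a finite-dimensional complex Hilbert space, let $\rho$ be a density operator on $A$ (positive semidefinite, $\operatorname{tr}\rho=1$), and let $\mathcal C$ be a compact convex set of positive semidefinite operators on $A$. For positive semidefinite $\sigma$ let $$D(\rho\|\sigma)=\operatorname{tr}(\rho\log\rho)-\operatorname{tr}(\rho\log\sigma)\ \text{ if } \operatorname{supp}\rho\subseteq\operatorname{supp}\sigma,\qquad D(\rho\|\sigma)=+\infty\ \text{ otherwise}$$ be the Umegaki relative entropy, and let $$D_{\mathbb M}(\rho\|\sigma)=\sup_{M}\sum_{x}\operatorname{tr}(\rho M_x)\log\frac{\operatorname{tr}(\rho M_x)}{\operatorname{tr}(\sigma M_x)}$$ be the measured relative entropy, where the supremum is over all POVMs $M=(M_x)_x$ with finitely many outcomes ($M_x\ge 0$, $\sum_x M_x=I$), a summand is $0$ if $\operatorname{tr}(\rho M_x)=0$, and it is $+\infty$ if $\operatorname{tr}(\sigma M_x)=0<\operatorname{tr}(\rho M_x)$. All logarithms are natural. For a set $\mathcal S$ of positive semidefinite operators put $D(\rho\|\mathcal S)=\inf_{\sigma\in\mathcal S}D(\rho\|\sigma)$ and $D_{\mathbb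 M}(\rho\|\mathcal S)=\inf_{\sigma\in\mathcal S}D_{\mathbb M}(\rho\|\sigma)$, with values in $[-\infty,+\infty]$ and $\inf\emptyset=+\infty$. Let $\mathcal C^\circ=\{X \text{ Hermitian}:\operatorname{tr}(XY)\le 1\ \text{for all } Y\in\mathcal C\}$ be the polar set of $\mathcal C$ and let $\mathcal C^\circ_{++}$ be the set of positive definite elements of $\mathcal C^\circ$. If $D(\rho\|\mathcal C)\neq+\infty$, then $$D(\rho\|\mathcal C)+D_{\mathbb M}(\rho\|\mathcal C^\circ_{++})=D(\rho\|I).$$ Moreover, in every case, including $D(\rho\|\mathcal C)=+\infty$, $$D(\rho\|\mathcal C)=D(\rho\|I)-D_{\mathbb M}(\rho\|\mathcal C^\circ_{++})$$ as elements of $[-\infty,+\infty]$, where $D(\rho\|I)=\operatorname{tr}(\rho\log\rho)$ is finite; in particular $D_{\mathbb M}(\rho\|\mathcal C^\circ_{++})=-\infty$ when $D(\rho\|\mathcal C)=+\infty$. -/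

import Mathlib

open scoped ComplexOrder

/-- Density operators: positive semidefinite with unit trace. -/
def IsDensityOperator {n : Type*} [Fintype n] (ρ : Matrix n n ℂ) : Prop :=
  ρ.PosSemidef ∧ ρ.trace = 1

/-- The support of a Hermitian operator, i.e. its range. -/
def operatorSupport {n : Type*} [Fintype n] (ρ : Matrix n n ℂ) : Submodule ℂ (n → ℂ) :=
  LinearMap.range ρ.mulVecLin

open Classical in
/-- The Umegaki relative entropy `D(ρ‖σ) = tr (ρ log ρ) - tr (ρ log σ)` if
`supp ρ ⊆ supp σ`, and `+∞` otherwise. The logarithm is the natural one, applied by functional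
calculus; since `Real.log 0 = 0`, it is the logarithm on the support and zero on the kernel. -/
noncomputable def umegakiEntropy {n : Type*} [Fintype n] [DecidableEq n]
    (ρ σ : Matrix n n ℂ) : EReal :=
  if operatorSupport ρ ≤ operatorSupport σ then
    (((ρ * cfc Real.log ρ).trace.re - (ρ * cfc Real.log σ).trace.re : ℝ) : EReal)
  else ⊤

/-- A positive operator-valued measure with outcome set `X`. -/
structure POVM (n X : Type*) [Fintype n] [DecidableEq n] [Fintype X] where
  /-- The measurement operators. -/
  op : X → Matrix n n ℂ
  posSemidef : ∀ x, (op x).PosSemidef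
  sum_eq_one : ∑ x, op x = 1

/-- The outcome distribution `P_{ρ,M}(x) = tr (ρ M_x)`. -/
noncomputable def POVM.prob {n X : Type*} [Fintype n] [DecidableEq n] [Fintype X]
    (M : POVM n X) (ρ : Matrix n n ℂ) (x : X) : ℝ :=
  (ρ * M.op x).trace.re

open Classical in
/-- The summand `q f(p/q)` for `f(t) = t log t`, with the conventions `0 f(0/0) = 0` and
`0 f(p/0) = +∞` for `p > 0`. -/
noncomputable def klSummand (p q : ℝ) : EReal :=
  if q = 0 then (if p = 0 then 0 else ⊤)
  else ((q * ((p / q) * Real.log (p / q)) : ℝ) : EReal)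

/-- The Kullback-Leibler divergence of two nonnegative vectors. -/
noncomputable def klDivergence {X : Type*} [Fintype X] (P Q : X → ℝ) : EReal :=
  ∑ x, klSummand (P x) (Q x)

/-- The measured relative entropy: the supremum, over all POVMs with finitely many outcomes, of
the Kullback-Leibler divergence between the outcome distributions. -/
noncomputable def measuredEntropy {n : Type*} [Fintype n] [DecidableEq n]
    (ρ σ : Matrix n n ℂ) : EReal :=
  ⨆ (k : ℕ) (M : POVM n (Fin k)), klDivergence (M.prob ρ) (M.prob σ)

/-- The divergence `inf_{σ ∈ C} 𝔻(ρ‖σ)` to a set `C`. -/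
noncomputable def divergenceToSet {n : Type*}
    (𝔻 : Matrix n n ℂ → Matrix n n ℂ → EReal) (ρ : Matrix n n ℂ) (C : Set (Matrix n n ℂ)) :
    EReal :=
  ⨅ σ ∈ C, 𝔻 ρ σ

/-- The polar set `C° = {X Hermitian : tr (X Y) ≤ 1 for all Y ∈ C}`. -/
def polarSet {n : Type*} [Fintype n] (C : Set (Matrix n n ℂ)) : Set (Matrix n n ℂ) :=
  {X | X.IsHermitian ∧ ∀ Y ∈ C, (X * Y).trace.re ≤ 1}

/-- The positive definite part `C° ∩ PD` of the polar set. -/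
def polarSetPosDef {n : Type*} [Fintype n] (C : Set (Matrix n n ℂ)) : Set (Matrix n n ℂ) :=
  polarSet C ∩ {X | X.PosDef}

section
open scoped ComplexOrder
open Matrix MeasureTheory Set Filter Topology

/-! The entropy term of `ρ` splits off, and the claim becomes a minimax identity: the supremum of
`tr (ρ log τ)` over the `τ ∈ C` whose support contains that of `ρ` equals the infimum of the
measured entropy over positive definite `σ` in the polar set.

The bound `≤` (`logTrace_le_measuredEntropy`) comes from measuring in an eigenbasis of `τ` and using
`log x ≤ x - 1`; the error terms add up to `tr (σ τ) - 1 ≤ 0`.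

For `≥`, `C` is shifted by a small multiple of the identity, so that `τ ↦ tr (ρ log τ)` is
continuous and has a maximiser `τ`. Its gradient there is `S = ∫₀^∞ (τ + s)⁻¹ ρ (τ + s)⁻¹ ds`, and
first-order optimality puts `S` in the polar of the shifted set (`exists_fderivLog_mem_polar`). The
measured entropy of `ρ` relative to `S` is at most `tr (ρ log τ)` (`measuredEntropy_le_logTrace`),
and the slack created by the shift pays for making `S` positive definite.

Both the concavity of `tr (ρ log τ)` and the entropy bound follow from one inequality,
`exists_log_tangent`. It is applied once to the spectral projections of another operator and once to
the effects of a POVM. -/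

/-! ### Scalar integrals behind the logarithm. -/

lemma hasDerivAt_neg_inv_add {a s : ℝ} (h : a + s ≠ 0) :
    HasDerivAt (fun s : ℝ => -(a + s)⁻¹) ((a + s)⁻¹ * (a + s)⁻¹) s := by
  refine (((hasDerivAt_id' s).const_add a).fun_inv h).fun_neg.congr_deriv ?_
  field_simp

lemma tendsto_neg_inv_add (a : ℝ) :
    Tendsto (fun s : ℝ => -(a + s)⁻¹) atTop (𝓝 0) := by
  simpa using (tendsto_inv_atTop_zero.comp (tendsto_atTop_add_const_left atTop a tendsto_id)).neg

lemma integrableOn_inv_mul_inv_self {a : ℝ} (ha : 0 < a) :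
    IntegrableOn (fun s : ℝ => (a + s)⁻¹ * (a + s)⁻¹) (Ioi 0) := by
  refine integrableOn_Ioi_deriv_of_nonneg' (g := fun s => -(a + s)⁻¹) (l := 0)
    (fun s hs => hasDerivAt_neg_inv_add ?_) (fun s _ => mul_self_nonneg _) (tendsto_neg_inv_add a)
  have : 0 ≤ s := hs
  positivity

lemma integral_inv_mul_inv_self {a : ℝ} (ha : 0 < a) :
    ∫ s in Ioi (0 : ℝ), (a + s)⁻¹ * (a + s)⁻¹ = a⁻¹ := by
  have := integral_Ioi_of_hasDerivAt_of_tendsto' (a := 0) (f := fun s => -(a + s)⁻¹)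
    (fun s hs => hasDerivAt_neg_inv_add (a := a) (s := s) (by
      have : 0 ≤ s := hs
      positivity)) (integrableOn_inv_mul_inv_self ha) (tendsto_neg_inv_add a)
  simpa using this

lemma integrableOn_inv_mul_inv {a b : ℝ} (ha : 0 < a) (hb : 0 < b) :
    IntegrableOn (fun s : ℝ => (a + s)⁻¹ * (b + s)⁻¹) (Ioi 0) := by
  have hm : 0 < min a b := lt_min ha hb
  refine Integrable.mono' (integrableOn_inv_mul_inv_self hm) ?_ ?_
  · exact (by fun_prop : Measurable fun s : ℝ => (a + s)⁻¹ * (b + s)⁻¹).aestronglyMeasurable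
  · filter_upwards [ae_restrict_mem measurableSet_Ioi] with s hs
    have hs : 0 < s := hs
    rw [Real.norm_of_nonneg (by positivity)]
    gcongr
    · exact min_le_left _ _
    · exact min_le_right _ _

lemma integrableOn_inv_sub_inv {a b : ℝ} (ha : 0 < a) (hb : 0 < b) :
    IntegrableOn (fun s : ℝ => (a + s)⁻¹ - (b + s)⁻¹) (Ioi 0) := by
  have : IntegrableOn (fun s : ℝ => (b - a) * ((a + s)⁻¹ * (b + s)⁻¹)) (Ioi 0) :=
    (integrableOn_inv_mul_inv ha hb).const_mul (b - a)
  refine IntegrableOn.congr_fun this (fun s hs => ?_) measurableSet_Ioi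
  have hs : 0 < s := hs
  have h1 : a + s ≠ 0 := by positivity
  have h2 : b + s ≠ 0 := by positivity
  field_simp
  ring

lemma integral_inv_sub_inv {a b : ℝ} (ha : 0 < a) (hb : 0 < b) :
    ∫ s in Ioi (0 : ℝ), ((a + s)⁻¹ - (b + s)⁻¹) = Real.log b - Real.log a := by
  have hd : ∀ s ∈ Ici (0 : ℝ), HasDerivAt (fun s : ℝ => Real.log ((a + s) / (b + s)))
      ((a + s)⁻¹ - (b + s)⁻¹) s := by
    intro s hs
    have hs : 0 ≤ s := hs
    have h1 : a + s ≠ 0 := by positivity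
    have h2 : b + s ≠ 0 := by positivity
    refine ((((hasDerivAt_id' s).const_add a).fun_div ((hasDerivAt_id' s).const_add b) h2).log
      (div_ne_zero h1 h2)).congr_deriv ?_
    field_simp
  have hlim : Tendsto (fun s : ℝ => Real.log ((a + s) / (b + s))) atTop (𝓝 0) := by
    have h1 : Tendsto (fun s : ℝ => 1 + (a - b) * (b + s)⁻¹) atTop (𝓝 (1 + (a - b) * 0)) :=
      ((tendsto_inv_atTop_zero.comp
        (tendsto_atTop_add_const_left atTop b tendsto_id)).const_mul _).const_add _
    rw [mul_zero, add_zero] at h1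
    have h2 := (Real.continuousAt_log one_ne_zero).tendsto.comp h1
    rw [Real.log_one] at h2
    refine h2.congr' ?_
    filter_upwards [eventually_gt_atTop 0] with s hs
    have : b + s ≠ 0 := by positivity
    simp only [Function.comp]
    congr 1
    field_simp
    ring
  rw [integral_Ioi_of_hasDerivAt_of_tendsto' hd (integrableOn_inv_sub_inv ha hb) hlim]
  simp only [add_zero]
  rw [Real.log_div ha.ne' hb.ne']
  ring

/-- The integrand `(a - l) (b - l) / ((l + s) (a + s) (b + s))`. -/
noncomputable def logKernel (l a b s : ℝ) : ℝ :=
  (l + s)⁻¹ * ((a - l) * (a + s)⁻¹) * ((b - l) * (b + s)⁻¹)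

/-- Writing `a - l = (a + s) - (l + s)`, and likewise for `b`, expands the kernel to `1/(l+s) -
1/(a+s) - 1/(b+s) + (l+s)/((a+s)(b+s))`. Subtracting the case `l = 1` isolates the dependence on
`l`: a logarithm and a linear term after integration. -/
lemma logKernel_eq {l a b s : ℝ} (hl : 0 < l) (ha : 0 < a) (hb : 0 < b) (hs : 0 < s) :
    logKernel l a b s = ((l + s)⁻¹ - (1 + s)⁻¹) + logKernel 1 a b s
      + (l - 1) * ((a + s)⁻¹ * (b + s)⁻¹) := by
  have h0 : l + s ≠ 0 := by positivity
  have h1 : a + s ≠ 0 := by positivity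
  have h2 : b + s ≠ 0 := by positivity
  have h3 : 1 + s ≠ 0 := by positivity
  unfold logKernel
  field_simp
  ring

lemma integrableOn_logKernel {l a b : ℝ} (hl : 0 < l) (ha : 0 < a) (hb : 0 < b) :
    IntegrableOn (fun s => logKernel l a b s) (Ioi 0) := by
  have : IntegrableOn (fun s : ℝ =>
      (a - l) * ((l + s)⁻¹ * (a + s)⁻¹ - (b + s)⁻¹ * (a + s)⁻¹)) (Ioi 0) :=
    ((integrableOn_inv_mul_inv hl ha).sub (integrableOn_inv_mul_inv hb ha)).const_mul _
  refine IntegrableOn.congr_fun this (fun s hs => ?_) measurableSet_Ioi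
  have hs : 0 < s := hs
  have h0 : l + s ≠ 0 := by positivity
  have h1 : a + s ≠ 0 := by positivity
  have h2 : b + s ≠ 0 := by positivity
  simp only [logKernel]
  field_simp
  ring

lemma integral_logKernel {l a b : ℝ} (hl : 0 < l) (ha : 0 < a) (hb : 0 < b) :
    ∫ s in Ioi (0 : ℝ), logKernel l a b s = - Real.log l + (∫ s in Ioi (0 : ℝ), logKernel 1 a b s)
      + (l - 1) * ∫ s in Ioi (0 : ℝ), (a + s)⁻¹ * (b + s)⁻¹ := by
  have hi := integrableOn_inv_sub_inv hl one_pos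
  have hk := integrableOn_logKernel one_pos ha hb
  rw [setIntegral_congr_fun measurableSet_Ioi (fun s hs => logKernel_eq hl ha hb hs)]
  rw [integral_add (f := fun s => (l + s)⁻¹ - (1 + s)⁻¹ + logKernel 1 a b s) (hi.add hk)
      ((integrableOn_inv_mul_inv ha hb).const_mul _),
    integral_add (f := fun s => (l + s)⁻¹ - (1 + s)⁻¹) hi hk,
    integral_inv_sub_inv hl one_pos, integral_const_mul]
  simp

lemma integral_logKernel_self {a : ℝ} (ha : 0 < a) :
    ∫ s in Ioi (0 : ℝ), logKernel 1 a a s = Real.log a - 1 + a⁻¹ := by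
  -- At `l = a` the kernel vanishes identically, which determines the integral at `l = 1`.
  have h := integral_logKernel ha ha ha
  rw [integral_inv_mul_inv_self ha] at h
  have h0 : ∫ s in Ioi (0 : ℝ), logKernel a a a s = 0 := by simp [logKernel]
  have : a * a⁻¹ = 1 := mul_inv_cancel₀ ha.ne'
  linarith

/-! ### Matrices and traces in a unitary eigenbasis. -/

section Diagonalization
variable {n : Type*} [Fintype n] [DecidableEq n]

/-- The matrix `U diag(φ) Uᴴ`. -/
noncomputable def conjDiag (U : unitaryGroup n ℂ) (φ : n → ℝ) : Matrix n n ℂ :=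
  (U : Matrix n n ℂ) * diagonal (fun i => (φ i : ℂ)) * (U : Matrix n n ℂ)ᴴ

/-- The matrix of `X` in the basis of columns of `U`. -/
noncomputable def inBasis (U : unitaryGroup n ℂ) (X : Matrix n n ℂ) : Matrix n n ℂ :=
  (U : Matrix n n ℂ)ᴴ * X * (U : Matrix n n ℂ)

/-- The real part of the product of opposite entries of `X` and `Y` in the basis `U`. -/
noncomputable def pairing (U : unitaryGroup n ℂ) (X Y : Matrix n n ℂ) (i j : n) : ℝ :=
  (inBasis U X i j * inBasis U Y j i).re

lemma conjTranspose_mul_unitary (U : unitaryGroup n ℂ) :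
    (U : Matrix n n ℂ)ᴴ * (U : Matrix n n ℂ) = 1 := UnitaryGroup.star_mul_self U

lemma unitary_mul_conjTranspose (U : unitaryGroup n ℂ) :
    (U : Matrix n n ℂ) * (U : Matrix n n ℂ)ᴴ = 1 := (mem_unitaryGroup_iff.mp U.2)

lemma conjDiag_mul (U : unitaryGroup n ℂ) (φ ψ : n → ℝ) :
    conjDiag U φ * conjDiag U ψ = conjDiag U (fun i => φ i * ψ i) := by
  unfold conjDiag
  calc _ = (U : Matrix n n ℂ) * diagonal (fun i => (φ i : ℂ)) *
        ((U : Matrix n n ℂ)ᴴ * (U : Matrix n n ℂ)) * diagonal (fun i => (ψ i : ℂ)) *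
        (U : Matrix n n ℂ)ᴴ := by simp only [Matrix.mul_assoc]
    _ = _ := by
      rw [conjTranspose_mul_unitary, Matrix.mul_one, Matrix.mul_assoc _ (diagonal _) (diagonal _),
        diagonal_mul_diagonal]
      simp

lemma conjDiag_one (U : unitaryGroup n ℂ) : conjDiag U (fun _ => 1) = 1 := by
  simp [conjDiag, unitary_mul_conjTranspose]

lemma conjDiag_add (U : unitaryGroup n ℂ) (φ ψ : n → ℝ) :
    conjDiag U φ + conjDiag U ψ = conjDiag U (fun i => φ i + ψ i) := by
  simp only [conjDiag, ← Matrix.add_mul, ← Matrix.mul_add, diagonal_add]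
  simp

lemma smul_conjDiag (U : unitaryGroup n ℂ) (c : ℝ) (φ : n → ℝ) :
    c • conjDiag U φ = conjDiag U (fun i => c * φ i) := by
  have : diagonal (fun i => ((c * φ i : ℝ) : ℂ)) = c • diagonal (fun i => (φ i : ℂ)) := by
    ext i j
    by_cases h : i = j
    · subst h; simp
    · simp [h]
  rw [conjDiag, conjDiag, this]
  simp

lemma conjDiag_isHermitian (U : unitaryGroup n ℂ) (φ : n → ℝ) : (conjDiag U φ).IsHermitian := by
  unfold conjDiag IsHermitian
  simp only [conjTranspose_mul, conjTranspose_conjTranspose, diagonal_conjTranspose,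
    Matrix.mul_assoc]
  congr 3
  ext i
  simp

lemma conjDiag_posSemidef (U : unitaryGroup n ℂ) {φ : n → ℝ} (h : ∀ i, 0 ≤ φ i) :
    (conjDiag U φ).PosSemidef := by
  refine PosSemidef.mul_mul_conjTranspose_same (PosSemidef.diagonal fun i => ?_) _
  simpa using h i

lemma inBasis_conjDiag (U : unitaryGroup n ℂ) (φ : n → ℝ) :
    inBasis U (conjDiag U φ) = diagonal (fun i => (φ i : ℂ)) := by
  unfold inBasis conjDiag
  simp only [Matrix.mul_assoc, conjTranspose_mul_unitary, Matrix.mul_one]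
  rw [← Matrix.mul_assoc, conjTranspose_mul_unitary, Matrix.one_mul]

lemma conj_inBasis (U : unitaryGroup n ℂ) (X : Matrix n n ℂ) :
    (U : Matrix n n ℂ) * inBasis U X * (U : Matrix n n ℂ)ᴴ = X := by
  unfold inBasis
  simp only [Matrix.mul_assoc, unitary_mul_conjTranspose, Matrix.mul_one]
  rw [← Matrix.mul_assoc, unitary_mul_conjTranspose, Matrix.one_mul]

lemma inBasis_mul (U : unitaryGroup n ℂ) (X Y : Matrix n n ℂ) :
    inBasis U (X * Y) = inBasis U X * inBasis U Y := by
  have h : inBasis U X * inBasis U Y = (U : Matrix n n ℂ)ᴴ * X *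
      ((U : Matrix n n ℂ) * (U : Matrix n n ℂ)ᴴ) * Y * (U : Matrix n n ℂ) := by
    simp only [inBasis, Matrix.mul_assoc]
  rw [h, unitary_mul_conjTranspose, Matrix.mul_one, inBasis, Matrix.mul_assoc _ X Y]

lemma trace_inBasis (U : unitaryGroup n ℂ) (X : Matrix n n ℂ) :
    (inBasis U X).trace = X.trace := by
  rw [inBasis, trace_mul_comm, ← Matrix.mul_assoc, unitary_mul_conjTranspose, Matrix.one_mul]

lemma inBasis_posSemidef (U : unitaryGroup n ℂ) {X : Matrix n n ℂ} (h : X.PosSemidef) :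
    (inBasis U X).PosSemidef := h.conjTranspose_mul_mul_same _

lemma inBasis_isHermitian (U : unitaryGroup n ℂ) {X : Matrix n n ℂ} (h : X.IsHermitian) :
    (inBasis U X).IsHermitian := isHermitian_conjTranspose_mul_mul _ h

lemma inBasis_add (U : unitaryGroup n ℂ) (X Y : Matrix n n ℂ) :
    inBasis U (X + Y) = inBasis U X + inBasis U Y := by
  simp [inBasis, Matrix.mul_add, Matrix.add_mul]

lemma re_trace_mul (U : unitaryGroup n ℂ) (X Y : Matrix n n ℂ) :
    (X * Y).trace.re = ∑ i, ∑ j, pairing U X Y i j := by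
  rw [← trace_inBasis U, inBasis_mul]
  simp [Matrix.trace, Matrix.mul_apply, pairing]

lemma re_trace_mul_conjDiag_mul (U : unitaryGroup n ℂ) (X Y : Matrix n n ℂ) (φ ψ : n → ℝ) :
    (X * (conjDiag U φ * Y * conjDiag U ψ)).trace.re
      = ∑ i, ∑ j, pairing U X Y i j * (φ j * ψ i) := by
  rw [re_trace_mul U]
  refine Finset.sum_congr rfl fun i _ => Finset.sum_congr rfl fun j _ => ?_
  simp only [pairing, inBasis_mul, inBasis_conjDiag, mul_diagonal, diagonal_mul]
  rw [show inBasis U X i j * ((φ j : ℂ) * inBasis U Y j i * (ψ i : ℂ))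
    = ((φ j * ψ i : ℝ) : ℂ) * (inBasis U X i j * inBasis U Y j i) by push_cast; ring,
    Complex.re_ofReal_mul, mul_comm]

lemma re_trace_mul_conjDiag (U : unitaryGroup n ℂ) (X : Matrix n n ℂ) (φ : n → ℝ) :
    (X * conjDiag U φ).trace.re = ∑ i, (inBasis U X i i).re * φ i := by
  rw [← trace_inBasis U, inBasis_mul, inBasis_conjDiag]
  simp [Matrix.trace, Matrix.mul_apply, diagonal_apply]

lemma re_trace_mul_nonneg {X Y : Matrix n n ℂ} (hX : X.PosSemidef) (hY : Y.PosSemidef) :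
    0 ≤ (X * Y).trace.re := by
  obtain ⟨B, rfl⟩ : ∃ B : Matrix n n ℂ, Y = B * Bᴴ := by
    open scoped MatrixOrder in
    obtain ⟨B, hB⟩ := CStarAlgebra.nonneg_iff_eq_star_mul_self.mp hY.nonneg
    exact ⟨Bᴴ, by simpa [star_eq_conjTranspose] using hB⟩
  rw [← Matrix.mul_assoc, trace_mul_comm, ← Matrix.mul_assoc]
  exact (Complex.le_def.mp (hX.conjTranspose_mul_mul_same B).trace_nonneg).1

lemma eq_conjDiag {A : Matrix n n ℂ} (hA : A.IsHermitian) :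
    A = conjDiag hA.eigenvectorUnitary hA.eigenvalues := hA.spectral_theorem

lemma cfc_eq_conjDiag {A : Matrix n n ℂ} (hA : A.IsHermitian) (f : ℝ → ℝ) :
    cfc f A = conjDiag hA.eigenvectorUnitary (fun i => f (hA.eigenvalues i)) := hA.cfc_eq f

lemma re_trace_mul_cfc {A : Matrix n n ℂ} (hA : A.IsHermitian) (X : Matrix n n ℂ) (f : ℝ → ℝ) :
    (X * cfc f A).trace.re
      = ∑ i, (inBasis hA.eigenvectorUnitary X i i).re * f (hA.eigenvalues i) := by
  rw [cfc_eq_conjDiag hA, re_trace_mul_conjDiag]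

lemma sum_re_inBasis (U : unitaryGroup n ℂ) (X : Matrix n n ℂ) :
    ∑ i, (inBasis U X i i).re = X.trace.re := by
  rw [← trace_inBasis U]; simp [Matrix.trace]

lemma re_inBasis_nonneg (U : unitaryGroup n ℂ) {X : Matrix n n ℂ} (h : X.PosSemidef) (i : n) :
    0 ≤ (inBasis U X i i).re := (Complex.le_def.mp (inBasis_posSemidef U h).diag_nonneg).1

lemma norm_inBasis_le (U : unitaryGroup n ℂ) (X : Matrix n n ℂ) (i j : n) :
    ‖inBasis U X i j‖ ≤ ∑ a, ∑ b, ‖X a b‖ := by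
  have h : ∀ a b, ‖(U : Matrix n n ℂ) a b‖ ≤ 1 := entry_norm_bound_of_unitary U.2
  rw [inBasis, Matrix.mul_assoc, Matrix.mul_apply]
  refine (norm_sum_le _ _).trans (Finset.sum_le_sum fun a _ => ?_)
  rw [norm_mul, Matrix.mul_apply, conjTranspose_apply, norm_star]
  refine (mul_le_of_le_one_left (norm_nonneg _) (h _ _)).trans ?_
  refine (norm_sum_le _ _).trans (Finset.sum_le_sum fun b _ => ?_)
  rw [norm_mul]
  exact mul_le_of_le_one_right (norm_nonneg _) (h _ _)

end Diagonalization

/-! ### The derivative of the matrix logarithm and its tangent inequality. -/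

section LogDeriv
variable {n : Type*} [Fintype n] [DecidableEq n]

/-- The derivative of the matrix logarithm at `τ` in direction `ρ`,
`∫₀^∞ (τ + s)⁻¹ ρ (τ + s)⁻¹ ds`. -/
noncomputable def fderivLog (τ ρ : Matrix n n ℂ) : Matrix n n ℂ :=
  Matrix.of fun k l => ∫ s in Ioi (0 : ℝ), ((τ + s • 1)⁻¹ * ρ * (τ + s • 1)⁻¹) k l

lemma resolvent_eq {τ : Matrix n n ℂ} (hτ : τ.PosDef) {s : ℝ} (hs : 0 < s) :
    (τ + s • 1)⁻¹ = conjDiag hτ.1.eigenvectorUnitary (fun i => (hτ.1.eigenvalues i + s)⁻¹) := by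
  refine Matrix.inv_eq_right_inv ?_
  nth_rw 1 [eq_conjDiag hτ.1]
  rw [← conjDiag_one hτ.1.eigenvectorUnitary, smul_conjDiag, conjDiag_add, conjDiag_mul]
  congr 1
  ext i
  have := hτ.eigenvalues_pos i
  rw [mul_one, mul_inv_cancel₀ (by positivity)]

lemma resolvent_mul_mul_apply {τ : Matrix n n ℂ} (hτ : τ.PosDef) (ρ : Matrix n n ℂ) {s : ℝ}
    (hs : 0 < s) (k l : n) :
    ((τ + s • 1)⁻¹ * ρ * (τ + s • 1)⁻¹) k l = ∑ i, ∑ j,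
      (hτ.1.eigenvectorUnitary : Matrix n n ℂ) k i * inBasis hτ.1.eigenvectorUnitary ρ i j *
      star ((hτ.1.eigenvectorUnitary : Matrix n n ℂ) l j) *
      (((hτ.1.eigenvalues i + s)⁻¹ * (hτ.1.eigenvalues j + s)⁻¹ : ℝ) : ℂ) := by
  rw [resolvent_eq hτ hs]
  set U := hτ.1.eigenvectorUnitary
  set t := hτ.1.eigenvalues
  have : conjDiag U (fun i => (t i + s)⁻¹) * ρ * conjDiag U (fun i => (t i + s)⁻¹)
      = (U : Matrix n n ℂ) * (diagonal (fun i => (((t i + s)⁻¹ : ℝ) : ℂ)) * inBasis U ρ *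
        diagonal (fun i => (((t i + s)⁻¹ : ℝ) : ℂ))) * (U : Matrix n n ℂ)ᴴ := by
    simp only [conjDiag, inBasis, Matrix.mul_assoc]
  rw [this, Matrix.mul_assoc, Matrix.mul_apply]
  refine Finset.sum_congr rfl fun i _ => ?_
  rw [Matrix.mul_apply, Finset.mul_sum]
  refine Finset.sum_congr rfl fun j _ => ?_
  simp only [mul_diagonal, diagonal_mul, conjTranspose_apply]
  push_cast
  ring

lemma integrableOn_resolvent_mul_mul {τ : Matrix n n ℂ} (hτ : τ.PosDef) (ρ : Matrix n n ℂ)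
    (k l : n) :
    IntegrableOn (fun s : ℝ => ((τ + s • 1)⁻¹ * ρ * (τ + s • 1)⁻¹) k l) (Ioi 0) := by
  refine IntegrableOn.congr_fun (f := fun s : ℝ => ∑ i, ∑ j,
      (hτ.1.eigenvectorUnitary : Matrix n n ℂ) k i * inBasis hτ.1.eigenvectorUnitary ρ i j *
      star ((hτ.1.eigenvectorUnitary : Matrix n n ℂ) l j) *
      (((hτ.1.eigenvalues i + s)⁻¹ * (hτ.1.eigenvalues j + s)⁻¹ : ℝ) : ℂ)) ?_
    (fun s hs => (resolvent_mul_mul_apply hτ ρ hs k l).symm) measurableSet_Ioi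
  refine integrable_finsetSum _ fun i _ => integrable_finsetSum _ fun j _ => ?_
  exact (integrableOn_inv_mul_inv (hτ.eigenvalues_pos i) (hτ.eigenvalues_pos j)).ofReal.const_mul _

/-- The Hadamard form of `fderivLog` in an eigenbasis of `τ`. -/
lemma inBasis_fderivLog {τ : Matrix n n ℂ} (hτ : τ.PosDef) (ρ : Matrix n n ℂ) :
    inBasis hτ.1.eigenvectorUnitary (fderivLog τ ρ) = Matrix.of fun i j =>
      inBasis hτ.1.eigenvectorUnitary ρ i j * ((∫ s in Ioi (0 : ℝ),
        (hτ.1.eigenvalues i + s)⁻¹ * (hτ.1.eigenvalues j + s)⁻¹ : ℝ) : ℂ) := by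
  set U := hτ.1.eigenvectorUnitary with hU
  set X : Matrix n n ℂ := Matrix.of fun i j =>
      inBasis U ρ i j * ((∫ s in Ioi (0 : ℝ),
        (hτ.1.eigenvalues i + s)⁻¹ * (hτ.1.eigenvalues j + s)⁻¹ : ℝ) : ℂ) with hX
  have : fderivLog τ ρ = (U : Matrix n n ℂ) * X * (U : Matrix n n ℂ)ᴴ := by
    ext k l
    rw [fderivLog, Matrix.of_apply, setIntegral_congr_fun measurableSet_Ioi
      (fun s hs => resolvent_mul_mul_apply hτ ρ hs k l)]
    have hi : ∀ i j, IntegrableOn (fun s : ℝ =>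
        (((hτ.1.eigenvalues i + s)⁻¹ * (hτ.1.eigenvalues j + s)⁻¹ : ℝ) : ℂ)) (Ioi 0) := fun i j =>
      (integrableOn_inv_mul_inv (hτ.eigenvalues_pos i) (hτ.eigenvalues_pos j)).ofReal (𝕜 := ℂ)
    rw [integral_finsetSum _ fun i _ => integrable_finsetSum _ fun j _ => (hi i j).const_mul _,
      Matrix.mul_assoc, Matrix.mul_apply]
    refine Finset.sum_congr rfl fun i _ => ?_
    rw [integral_finsetSum _ fun j _ => (hi i j).const_mul _, Matrix.mul_apply, Finset.mul_sum]
    refine Finset.sum_congr rfl fun j _ => ?_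
    rw [integral_const_mul, hX, Matrix.of_apply, conjTranspose_apply]
    have : ∀ f : ℝ → ℝ, ∫ s in Ioi (0 : ℝ), ((f s : ℝ) : ℂ) = ((∫ s in Ioi (0 : ℝ), f s : ℝ) : ℂ) :=
      fun f => integral_ofReal
    rw [this]
    ring
  rw [this]
  unfold inBasis
  simp only [Matrix.mul_assoc, conjTranspose_mul_unitary, Matrix.mul_one]
  rw [← Matrix.mul_assoc, conjTranspose_mul_unitary, Matrix.one_mul]

lemma fderivLog_isHermitian {τ ρ : Matrix n n ℂ} (hτ : τ.PosDef) (hρ : ρ.IsHermitian) :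
    (fderivLog τ ρ).IsHermitian := by
  have h : (inBasis hτ.1.eigenvectorUnitary (fderivLog τ ρ)).IsHermitian := by
    rw [inBasis_fderivLog hτ]
    ext i j
    have := (inBasis_isHermitian hτ.1.eigenvectorUnitary hρ).apply i j
    simp only [conjTranspose_apply, Matrix.of_apply, star_mul', this]
    congr 1
    simp only [mul_comm, RCLike.star_def, Complex.conj_ofReal]
  rw [← conj_inBasis hτ.1.eigenvectorUnitary (fderivLog τ ρ)]
  exact isHermitian_mul_mul_conjTranspose _ h

lemma re_trace_fderivLog_mul {τ : Matrix n n ℂ} (hτ : τ.PosDef) (ρ M : Matrix n n ℂ) :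
    (fderivLog τ ρ * M).trace.re = ∑ i, ∑ j, pairing hτ.1.eigenvectorUnitary ρ M i j *
      ∫ s in Ioi (0 : ℝ), (hτ.1.eigenvalues j + s)⁻¹ * (hτ.1.eigenvalues i + s)⁻¹ := by
  rw [re_trace_mul hτ.1.eigenvectorUnitary]
  refine Finset.sum_congr rfl fun i _ => Finset.sum_congr rfl fun j _ => ?_
  rw [pairing, inBasis_fderivLog hτ, Matrix.of_apply, mul_right_comm, mul_comm,
    Complex.re_ofReal_mul, pairing, mul_comm]
  simp only [mul_comm]

/-- The trace is the integral over `s` of `tr (ρ R M R)`, with `R = (τ + s)⁻¹` Hermitian. -/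
lemma re_trace_fderivLog_mul_nonneg {τ ρ M : Matrix n n ℂ} (hτ : τ.PosDef) (hρ : ρ.PosSemidef)
    (hM : M.PosSemidef) : 0 ≤ (fderivLog τ ρ * M).trace.re := by
  rw [re_trace_fderivLog_mul hτ]
  have hi := fun i j => (integrableOn_inv_mul_inv (hτ.eigenvalues_pos j)
      (hτ.eigenvalues_pos i))
  simp_rw [← integral_const_mul]
  simp_rw [← integral_finsetSum Finset.univ fun j _ => (hi _ j).const_mul _]
  rw [← integral_finsetSum Finset.univ
    fun i _ => integrable_finsetSum _ fun j _ => (hi i j).const_mul _]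
  refine setIntegral_nonneg measurableSet_Ioi fun s _ => ?_
  rw [← re_trace_mul_conjDiag_mul hτ.1.eigenvectorUnitary ρ M
    (fun i => (hτ.1.eigenvalues i + s)⁻¹) (fun i => (hτ.1.eigenvalues i + s)⁻¹)]
  refine re_trace_mul_nonneg hρ ?_
  have := hM.conjTranspose_mul_mul_same
    (conjDiag hτ.1.eigenvectorUnitary (fun i => (hτ.1.eigenvalues i + s)⁻¹))
  rwa [conjDiag_isHermitian] at this

/-- `τ` commutes with its resolvents, and `∫₀^∞ t / (t + s)² ds = 1` for each eigenvalue `t`. -/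
lemma re_trace_fderivLog_mul_self {τ ρ : Matrix n n ℂ} (hτ : τ.PosDef) :
    (fderivLog τ ρ * τ).trace.re = ρ.trace.re := by
  rw [re_trace_fderivLog_mul hτ, ← sum_re_inBasis hτ.1.eigenvectorUnitary]
  refine Finset.sum_congr rfl fun i _ => ?_
  have h : inBasis hτ.1.eigenvectorUnitary τ = diagonal fun i => (hτ.1.eigenvalues i : ℂ) := by
    rw [← inBasis_conjDiag, ← eq_conjDiag hτ.1]
  rw [Finset.sum_eq_single i (fun j _ hj => by simp [pairing, h, hj]) (by simp)]
  have hp := hτ.eigenvalues_pos i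
  rw [integral_inv_mul_inv_self hp, pairing, h, diagonal_apply_eq, mul_comm (inBasis _ _ _ _),
    Complex.re_ofReal_mul]
  field_simp

lemma re_trace_fderivLog {τ ρ : Matrix n n ℂ} (hτ : τ.PosDef) :
    (fderivLog τ ρ).trace.re =
      ∑ i, (inBasis hτ.1.eigenvectorUnitary ρ i i).re * (hτ.1.eigenvalues i)⁻¹ := by
  rw [← sum_re_inBasis hτ.1.eigenvectorUnitary, inBasis_fderivLog hτ]
  refine Finset.sum_congr rfl fun i _ => ?_
  rw [Matrix.of_apply, integral_inv_mul_inv_self (hτ.eigenvalues_pos i), mul_comm,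
    Complex.re_ofReal_mul, mul_comm]

/-- The operator Jensen inequality for the logarithm at a base point `τ`, in a form which
separates the contributions of the parts `M` of a decomposition of unity. -/
lemma exists_log_tangent {τ ρ : Matrix n n ℂ} (hτ : τ.PosDef) (hρ : ρ.PosSemidef) :
    ∃ A : Matrix n n ℂ →+ ℝ, A 1 = (ρ * cfc Real.log τ).trace.re - ρ.trace.re ∧
      ∀ M : Matrix n n ℂ, M.PosSemidef → ∀ l : ℝ, 0 < l →
        (ρ * M).trace.re * Real.log l ≤ A M + l * (fderivLog τ ρ * M).trace.re := by
  set U := hτ.1.eigenvectorUnitary with hU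
  set t := hτ.1.eigenvalues with ht
  have tpos : ∀ i, 0 < t i := hτ.eigenvalues_pos
  let K : n → n → ℝ := fun i j => ∫ s in Ioi (0 : ℝ), logKernel 1 (t j) (t i) s
  have hadd : ∀ (M N : Matrix n n ℂ) i j,
      pairing U ρ (M + N) i j = pairing U ρ M i j + pairing U ρ N i j := by
    intro M N i j
    simp [pairing, inBasis_add, mul_add]
  -- `A` collects the terms that carry no factor `log l` or `l` in the integrated kernel. Additivity
  -- lets the inequalities for the parts of a decomposition of unity sum to `A 1`.
  refine ⟨AddMonoidHom.mk' (fun M => (∑ i, ∑ j, pairing U ρ M i j * K i j)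
    - (fderivLog τ ρ * M).trace.re) ?_, ?_, ?_⟩
  · intro M N
    simp only [hadd, add_mul, Finset.sum_add_distrib, Matrix.mul_add, trace_add, Complex.add_re]
    ring
  · have h1 : inBasis U (1 : Matrix n n ℂ) = 1 := by
      rw [inBasis, Matrix.mul_one, conjTranspose_mul_unitary]
    simp only [AddMonoidHom.mk'_apply, Matrix.mul_one]
    rw [re_trace_fderivLog hτ, re_trace_mul_cfc hτ.1, ← sum_re_inBasis U, ← Finset.sum_sub_distrib,
      ← Finset.sum_sub_distrib]
    refine Finset.sum_congr rfl fun i _ => ?_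
    rw [Finset.sum_eq_single i (fun j _ hj => by simp [pairing, h1, hj]) (by simp)]
    simp only [K, integral_logKernel_self (tpos i), pairing, h1, one_apply_eq, mul_one]
    ring
  · intro M hM l hl
    simp only [AddMonoidHom.mk'_apply]
    -- The sum is the integral of `(l + s)⁻¹ tr (ρ N M N)` with the Hermitian `N = (τ - l)(τ +
    -- s)⁻¹`, so the integrand is nonnegative.
    have key : 0 ≤ ∑ i, ∑ j, pairing U ρ M i j * ∫ s in Ioi (0 : ℝ), logKernel l (t j) (t i) s := by
      have hi := fun i j => integrableOn_logKernel hl (tpos j) (tpos i)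
      simp_rw [← integral_const_mul]
      simp_rw [← integral_finsetSum Finset.univ fun j _ => (hi _ j).const_mul _]
      rw [← integral_finsetSum Finset.univ
        fun i _ => integrable_finsetSum _ fun j _ => (hi i j).const_mul _]
      refine setIntegral_nonneg measurableSet_Ioi fun s hs => ?_
      have hs : 0 < s := hs
      have := re_trace_mul_conjDiag_mul U ρ M
        (fun i => (t i - l) * (t i + s)⁻¹) (fun i => (t i - l) * (t i + s)⁻¹)
      have hnn : 0 ≤ (ρ * (conjDiag U (fun i => (t i - l) * (t i + s)⁻¹) * M *
          conjDiag U (fun i => (t i - l) * (t i + s)⁻¹))).trace.re := by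
        refine re_trace_mul_nonneg hρ ?_
        have := hM.conjTranspose_mul_mul_same (conjDiag U (fun i => (t i - l) * (t i + s)⁻¹))
        rwa [conjDiag_isHermitian] at this
      rw [this] at hnn
      have hmul := mul_nonneg (inv_nonneg.mpr (by positivity : 0 ≤ l + s)) hnn
      simp only [Finset.mul_sum] at hmul
      refine hmul.trans_eq (Finset.sum_congr rfl fun i _ => Finset.sum_congr rfl fun j _ => ?_)
      unfold logKernel
      ring
    have hsum : ∑ i, ∑ j, pairing U ρ M i j * ∫ s in Ioi (0 : ℝ), logKernel l (t j) (t i) s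
        = - Real.log l * (ρ * M).trace.re + ∑ i, ∑ j, pairing U ρ M i j * K i j
          + (l - 1) * (fderivLog τ ρ * M).trace.re := by
      rw [re_trace_fderivLog_mul hτ, re_trace_mul U ρ M]
      simp only [Finset.mul_sum, ← Finset.sum_add_distrib]
      refine Finset.sum_congr rfl fun i _ => Finset.sum_congr rfl fun j _ => ?_
      rw [integral_logKernel hl (tpos j) (tpos i)]
      ring
    linarith

end LogDeriv

/-! ### Concavity, continuity and first-order optimality for `tr (ρ log τ)`. -/

section Optimality
variable {n : Type*} [Fintype n] [DecidableEq n]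

/-- The functional `τ ↦ tr (ρ log τ)`. -/
noncomputable def logTrace (ρ τ : Matrix n n ℂ) : ℝ := (ρ * cfc Real.log τ).trace.re

/-- The projection onto the `i`-th column of a unitary matrix. -/
noncomputable def columnProj (U : unitaryGroup n ℂ) (i : n) : Matrix n n ℂ :=
  conjDiag U (Pi.single i 1)

lemma columnProj_posSemidef (U : unitaryGroup n ℂ) (i : n) : (columnProj U i).PosSemidef :=
  conjDiag_posSemidef U fun j => by
    by_cases h : j = i
    · subst h; simp
    · simp [h]

lemma re_trace_mul_columnProj (U : unitaryGroup n ℂ) (X : Matrix n n ℂ) (i : n) :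
    (X * columnProj U i).trace.re = (inBasis U X i i).re := by
  rw [columnProj, re_trace_mul_conjDiag]
  simp [Pi.single_apply]

lemma sum_columnProj (U : unitaryGroup n ℂ) : ∑ i, columnProj U i = 1 := by
  have : ∀ s : Finset n, ∑ i ∈ s, columnProj U i
      = conjDiag U (fun j => ∑ i ∈ s, (Pi.single i 1 : n → ℝ) j) := by
    intro s
    induction s using Finset.induction_on with
    | empty => simp [conjDiag]
    | insert a s ha ih =>
      rw [Finset.sum_insert ha, ih, columnProj, conjDiag_add]
      simp only [Finset.sum_insert ha]
  rw [this, ← conjDiag_one U]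
  congr 1
  ext j
  simp [Pi.single_apply]

/-- Sum `exists_log_tangent` over the spectral projections of `ω`, with `l` the corresponding
eigenvalue. This is concavity in supergradient form, so differentiability is never needed. -/
lemma logTrace_le_tangent {τ ω ρ : Matrix n n ℂ} (hτ : τ.PosDef) (hω : ω.PosDef)
    (hρ : ρ.PosSemidef) :
    logTrace ρ ω ≤ logTrace ρ τ + (fderivLog τ ρ * (ω - τ)).trace.re := by
  obtain ⟨A, hA1, hA⟩ := exists_log_tangent hτ hρ
  set U := hω.1.eigenvectorUnitary with hU
  have h := Finset.sum_le_sum fun (i : n) (_ : i ∈ Finset.univ) =>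
    hA (columnProj U i) (columnProj_posSemidef U i) _ (hω.eigenvalues_pos i)
  rw [Finset.sum_add_distrib, ← map_sum, sum_columnProj, hA1] at h
  simp only [re_trace_mul_columnProj] at h
  have h1 : logTrace ρ ω = ∑ i, (inBasis U ρ i i).re * Real.log (hω.1.eigenvalues i) :=
    re_trace_mul_cfc hω.1 ρ Real.log
  have h2 : (fderivLog τ ρ * ω).trace.re
      = ∑ i, hω.1.eigenvalues i * (inBasis U (fderivLog τ ρ) i i).re := by
    have := re_trace_mul_conjDiag U (fderivLog τ ρ) hω.1.eigenvalues
    rw [← eq_conjDiag hω.1] at this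
    rw [this]
    exact Finset.sum_congr rfl fun i _ => mul_comm _ _
  rw [Matrix.mul_sub, trace_sub, Complex.sub_re, h1, h2, re_trace_fderivLog_mul_self hτ]
  unfold logTrace
  linarith

lemma posDef_of_sub_smul_one {n : Type*} [DecidableEq n] {τ : Matrix n n ℂ} {ε : ℝ} (hε : 0 < ε)
    (h : (τ - ε • (1 : Matrix n n ℂ)).PosSemidef) : τ.PosDef := by
  have h1 : (ε • (1 : Matrix n n ℂ)).PosDef := PosDef.one.smul hε
  simpa using h1.add_posSemidef h

lemma le_eigenvalues_of_sub_smul_one {τ : Matrix n n ℂ} (hτ : τ.IsHermitian) {ε : ℝ}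
    (h : (τ - ε • (1 : Matrix n n ℂ)).PosSemidef) (i : n) : ε ≤ hτ.eigenvalues i := by
  have h1 : τ - ε • (1 : Matrix n n ℂ)
      = conjDiag hτ.eigenvectorUnitary (fun i => hτ.eigenvalues i + (-ε) * 1) := by
    rw [← conjDiag_add, ← smul_conjDiag, conjDiag_one, ← eq_conjDiag hτ, neg_smul, sub_eq_add_neg]
  have h2 := (inBasis_posSemidef hτ.eigenvectorUnitary h).diag_nonneg (i := i)
  rw [h1, inBasis_conjDiag, diagonal_apply_eq] at h2
  have h3 : 0 ≤ hτ.eigenvalues i + (-ε) * 1 := by exact_mod_cast h2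
  linarith

lemma norm_resolvent_mul_mul_le {τ : Matrix n n ℂ} (ρ : Matrix n n ℂ) {ε : ℝ} (hε : 0 < ε)
    (h : (τ - ε • (1 : Matrix n n ℂ)).PosSemidef) {s : ℝ} (hs : 0 < s) (k l : n) :
    ‖((τ + s • 1)⁻¹ * ρ * (τ + s • 1)⁻¹) k l‖ ≤
      (∑ _i : n, ∑ _j : n, ∑ a, ∑ b, ‖ρ a b‖) * ((ε + s)⁻¹ * (ε + s)⁻¹) := by
  have hτ := posDef_of_sub_smul_one hε h
  have hle := le_eigenvalues_of_sub_smul_one hτ.1 h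
  have hu : ∀ a b, ‖(hτ.1.eigenvectorUnitary : Matrix n n ℂ) a b‖ ≤ 1 :=
    entry_norm_bound_of_unitary hτ.1.eigenvectorUnitary.2
  rw [resolvent_mul_mul_apply hτ ρ hs, Finset.sum_mul]
  refine (norm_sum_le _ _).trans (Finset.sum_le_sum fun i _ => ?_)
  rw [Finset.sum_mul]
  refine (norm_sum_le _ _).trans (Finset.sum_le_sum fun j _ => ?_)
  have hi := hle i
  have hj := hle j
  have hti := hτ.eigenvalues_pos i
  have htj := hτ.eigenvalues_pos j
  rw [norm_mul, norm_mul, norm_mul, norm_star, Complex.norm_real, Real.norm_of_nonneg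
    (by positivity)]
  have hS : 0 ≤ ∑ a, ∑ b, ‖ρ a b‖ :=
    Finset.sum_nonneg fun _ _ => Finset.sum_nonneg fun _ _ => norm_nonneg _
  refine mul_le_mul ?_ (by gcongr) (by positivity) hS
  refine (mul_le_of_le_one_right (by positivity) (hu _ _)).trans ?_
  exact (mul_le_of_le_one_left (norm_nonneg _) (hu _ _)).trans (norm_inBasis_le _ _ _ _)

lemma norm_fderivLog_apply_le {τ : Matrix n n ℂ} (ρ : Matrix n n ℂ) {ε : ℝ} (hε : 0 < ε)
    (h : (τ - ε • (1 : Matrix n n ℂ)).PosSemidef) (k l : n) :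
    ‖fderivLog τ ρ k l‖ ≤ (∑ _i : n, ∑ _j : n, ∑ a, ∑ b, ‖ρ a b‖) * ε⁻¹ := by
  rw [← integral_inv_mul_inv_self hε, ← integral_const_mul]
  refine norm_integral_le_of_norm_le ((integrableOn_inv_mul_inv_self hε).const_mul _) ?_
  filter_upwards [ae_restrict_mem measurableSet_Ioi] with s hs
  exact norm_resolvent_mul_mul_le ρ hε h hs k l

lemma abs_re_trace_fderivLog_mul_le (ρ : Matrix n n ℂ) {ε : ℝ} (hε : 0 < ε) :
    ∃ K : ℝ, ∀ τ : Matrix n n ℂ, (τ - ε • (1 : Matrix n n ℂ)).PosSemidef → ∀ X : Matrix n n ℂ,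
      |(fderivLog τ ρ * X).trace.re| ≤ K * ∑ a, ∑ b, ‖X a b‖ := by
  refine ⟨(∑ _i : n, ∑ _j : n, ∑ a, ∑ b, ‖ρ a b‖) * ε⁻¹, fun τ h X => ?_⟩
  refine (Complex.abs_re_le_norm _).trans ?_
  rw [Matrix.trace, Finset.sum_comm (f := fun a b => ‖X a b‖), Finset.mul_sum]
  refine (norm_sum_le _ _).trans (Finset.sum_le_sum fun i _ => ?_)
  rw [diag_apply, Matrix.mul_apply, Finset.mul_sum]
  refine (norm_sum_le _ _).trans (Finset.sum_le_sum fun j _ => ?_)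
  rw [norm_mul]
  exact mul_le_mul_of_nonneg_right (norm_fderivLog_apply_le ρ hε h i j) (norm_nonneg _)

/-- Dominated convergence: for `τ ≥ ε` the integrand is bounded by a constant times `(ε + s)⁻²`. -/
lemma continuousOn_fderivLog (ρ : Matrix n n ℂ) {ε : ℝ} (hε : 0 < ε) :
    ContinuousOn (fun τ => fderivLog τ ρ)
      {τ : Matrix n n ℂ | (τ - ε • (1 : Matrix n n ℂ)).PosSemidef} := by
  have : FirstCountableTopology (Matrix n n ℂ) :=
    inferInstanceAs (FirstCountableTopology (n → n → ℂ))
  refine continuousOn_pi.mpr fun k => continuousOn_pi.mpr fun l => fun τ hτ => ?_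
  refine continuousWithinAt_of_dominated
    (bound := fun s => (∑ _i : n, ∑ _j : n, ∑ a, ∑ b, ‖ρ a b‖) * ((ε + s)⁻¹ * (ε + s)⁻¹)) ?_ ?_
    ((integrableOn_inv_mul_inv_self hε).const_mul _) ?_
  · filter_upwards [self_mem_nhdsWithin] with τ hτ
    exact (integrableOn_resolvent_mul_mul (posDef_of_sub_smul_one hε hτ) ρ k l).1
  · filter_upwards [self_mem_nhdsWithin] with τ hτ
    filter_upwards [ae_restrict_mem measurableSet_Ioi] with s hs
    exact norm_resolvent_mul_mul_le ρ hε hτ hs k l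
  · filter_upwards [ae_restrict_mem measurableSet_Ioi] with s hs
    have hs : 0 < s := hs
    have hpd : (τ + s • (1 : Matrix n n ℂ)).PosDef :=
      (posDef_of_sub_smul_one hε hτ).add (PosDef.one.smul hs)
    have hdet : (τ + s • (1 : Matrix n n ℂ)).det ≠ 0 :=
      ((Matrix.isUnit_iff_isUnit_det _).mp hpd.isUnit).ne_zero
    have hinv : ContinuousAt (fun τ : Matrix n n ℂ => (τ + s • (1 : Matrix n n ℂ))⁻¹) τ := by
      refine ContinuousAt.comp (g := Inv.inv) (continuousAt_matrix_inv _ ?_)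
        (continuous_id.add continuous_const).continuousAt
      rw [Ring.inverse_eq_inv']
      exact continuousAt_inv₀ hdet
    have hmul := (hinv.mul (continuousAt_const (y := ρ))).mul hinv
    exact ((continuous_apply_apply k l).continuousAt.comp hmul).continuousWithinAt

/-- The tangent inequalities at two points, with the uniform bound on the gradient, give a Lipschitz
estimate. -/
lemma continuousOn_logTrace {ρ : Matrix n n ℂ} (hρ : ρ.PosSemidef) {ε : ℝ} (hε : 0 < ε) :
    ContinuousOn (logTrace ρ)
      {τ : Matrix n n ℂ | (τ - ε • (1 : Matrix n n ℂ)).PosSemidef} := by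
  obtain ⟨K, hK⟩ := abs_re_trace_fderivLog_mul_le ρ hε
  intro τ hτ
  have hlip : ∀ ω : Matrix n n ℂ, (ω - ε • (1 : Matrix n n ℂ)).PosSemidef →
      dist (logTrace ρ ω) (logTrace ρ τ) ≤ K * ∑ a, ∑ b, ‖(ω - τ) a b‖ := by
    intro ω hω
    have pτ := posDef_of_sub_smul_one hε hτ
    have pω := posDef_of_sub_smul_one hε hω
    have h1 := logTrace_le_tangent pτ pω hρ
    have h2 := logTrace_le_tangent pω pτ hρ
    have h3 := (abs_le.mp (hK τ hτ (ω - τ))).2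
    have h4 := (abs_le.mp (hK ω hω (τ - ω))).2
    have h5 : ∑ a, ∑ b, ‖(τ - ω) a b‖ = ∑ a, ∑ b, ‖(ω - τ) a b‖ := by
      simp only [Matrix.sub_apply, norm_sub_rev]
    rw [h5] at h4
    rw [Real.dist_eq, abs_le]
    constructor <;> linarith
  refine tendsto_iff_dist_tendsto_zero.mpr (squeeze_zero' (Eventually.of_forall fun _ =>
    dist_nonneg) (eventually_nhdsWithin_of_forall hlip) ?_)
  have hc : Continuous fun ω : Matrix n n ℂ => K * ∑ a, ∑ b, ‖(ω - τ) a b‖ := by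
    refine continuous_const.mul (continuous_finsetSum _ fun a _ => continuous_finsetSum _
      fun b _ => ((continuous_apply_apply a b).comp (continuous_id.sub continuous_const)).norm)
  have := (hc.tendsto τ).mono_left (nhdsWithin_le_nhds
    (s := {τ : Matrix n n ℂ | (τ - ε • (1 : Matrix n n ℂ)).PosSemidef}))
  simpa using this

/-- First-order optimality of a maximiser of `tr (ρ log τ)` over a compact convex set. -/
lemma exists_fderivLog_mem_polar {ρ : Matrix n n ℂ} (hρ : IsDensityOperator ρ)
    {C : Set (Matrix n n ℂ)} (hne : C.Nonempty) (hcomp : IsCompact C) (hconv : Convex ℝ C)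
    {ε : ℝ} (hε : 0 < ε) (hC : ∀ τ ∈ C, (τ - ε • (1 : Matrix n n ℂ)).PosSemidef) :
    ∃ τ ∈ C, ∀ ω ∈ C, (fderivLog τ ρ * ω).trace.re ≤ 1 := by
  obtain ⟨τ, hτC, hmax⟩ := hcomp.exists_isMaxOn hne ((continuousOn_logTrace hρ.1 hε).mono hC)
  refine ⟨τ, hτC, fun ω hω => ?_⟩
  have hpd := fun σ hσ => posDef_of_sub_smul_one hε (hC σ hσ)
  let γ : ℝ → Matrix n n ℂ := fun h => τ + h • (ω - τ)
  have hγC : ∀ h ∈ Icc (0 : ℝ) 1, γ h ∈ C := fun h hh =>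
    hconv.add_smul_sub_mem hτC hω hh
  -- The tangent inequality is based at `γ h` and evaluated at the maximiser `τ`, which fixes the
  -- sign of the slope at `γ h`; continuity of the gradient then carries it to `h = 0`.
  have hle : ∀ h ∈ Ioc (0 : ℝ) 1, (fderivLog (γ h) ρ * (ω - τ)).trace.re ≤ 0 := by
    intro h hh
    have hm := hγC h ⟨hh.1.le, hh.2⟩
    have h1 := logTrace_le_tangent (hpd _ hm) (hpd _ hτC) hρ.1
    have h2 : logTrace ρ (γ h) ≤ logTrace ρ τ := hmax hm
    have h3 : τ - γ h = (-h) • (ω - τ) := by simp [γ]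
    rw [h3, Matrix.mul_smul, trace_smul, Complex.smul_re, smul_eq_mul] at h1
    nlinarith [hh.1]
  have hlim : Tendsto (fun h => (fderivLog (γ h) ρ * (ω - τ)).trace.re) (𝓝[Ioc 0 1] 0)
      (𝓝 (fderivLog τ ρ * (ω - τ)).trace.re) := by
    have hγ : ContinuousWithinAt γ (Ioc 0 1) 0 := by
      have : Continuous γ := by fun_prop
      exact this.continuousWithinAt
    have hγ0 : γ 0 = τ := by simp [γ]
    have h1 : ContinuousWithinAt (fun h => fderivLog (γ h) ρ) (Ioc 0 1) 0 := by
      refine ContinuousWithinAt.comp (g := fun τ => fderivLog τ ρ)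
        (t := {τ : Matrix n n ℂ | (τ - ε • (1 : Matrix n n ℂ)).PosSemidef}) ?_ hγ
        fun h hh => hC _ (hγC h ⟨hh.1.le, hh.2⟩)
      rw [hγ0]
      exact continuousOn_fderivLog ρ hε τ (hC τ hτC)
    have h2 : Continuous fun X : Matrix n n ℂ => (X * (ω - τ)).trace.re :=
      Complex.continuous_re.comp (continuous_id.matrix_mul continuous_const).matrix_trace
    have h3 := h2.continuousAt.comp_continuousWithinAt h1
    have h4 : Tendsto (fun h => (fderivLog (γ h) ρ * (ω - τ)).trace.re) (𝓝[Ioc 0 1] 0)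
      (𝓝 (fderivLog (γ 0) ρ * (ω - τ)).trace.re) := h3
    rwa [hγ0] at h4
  have hne0 : (𝓝[Ioc (0 : ℝ) 1] 0).NeBot := by
    rw [nhdsWithin_Ioc_eq_nhdsGT one_pos]
    infer_instance
  have hfin := le_of_tendsto hlim (eventually_nhdsWithin_of_forall hle)
  rw [Matrix.mul_sub, trace_sub, Complex.sub_re, re_trace_fderivLog_mul_self (hpd τ hτC),
    hρ.2, Complex.one_re] at hfin
  linarith

end Optimality

/-! ### Entropy bounds in both directions and regularisation by multiples of the identity. -/

section Entropy
variable {n : Type*} [Fintype n] [DecidableEq n]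

lemma EReal.coe_finsetSum {ι : Type*} (s : Finset ι) (f : ι → ℝ) :
    ((∑ i ∈ s, f i : ℝ) : EReal) = ∑ i ∈ s, (f i : EReal) :=
  map_sum (⟨⟨((↑) : ℝ → EReal), EReal.coe_zero⟩, EReal.coe_add⟩ : ℝ →+ EReal) f s

/-- If `p log l ≤ a + l q` for all `l > 0`, then `p log (p / q') ≤ a + p` for all `q' ≥ q`. -/
lemma klSummand_le {p q q' a : ℝ} (hp : 0 ≤ p) (hq : 0 ≤ q) (hqq : q ≤ q')
    (h : ∀ l : ℝ, 0 < l → p * Real.log l ≤ a + l * q) :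
    klSummand p q' ≤ ((a + p : ℝ) : EReal) := by
  unfold klSummand
  by_cases hq' : q' = 0
  · have hq0 : q = 0 := by linarith
    have hp0 : p = 0 := by
      by_contra hne
      have hpos : 0 < p := lt_of_le_of_ne hp (Ne.symm hne)
      -- With `q = 0` and `p > 0`, this choice of `l` makes the left side `a + 1`, exceeding `a`.
      have := h (Real.exp ((a + 1) / p)) (Real.exp_pos _)
      rw [Real.log_exp, mul_div_cancel₀ _ hne, hq0] at this
      linarith
    have := h 1 one_pos
    rw [if_pos hq', if_pos hp0]
    rw [hp0, hq0] at this
    have h0 : 0 ≤ a + p := by linarith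
    exact_mod_cast h0
  · rw [if_neg hq']
    have hq'pos : 0 < q' := lt_of_le_of_ne (hq.trans hqq) (Ne.symm hq')
    refine EReal.coe_le_coe_iff.mpr ?_
    rcases hp.eq_or_lt with hp0 | hpos
    · rw [← hp0]
      simp only [zero_div, zero_mul, mul_zero, add_zero]
      by_contra! hneg
      have hq1 : 0 < q + 1 := by linarith
      -- For `p = 0` and `a < 0` this `l` gives `a + l q = -l < 0`, a contradiction.
      have hl : 0 < -a / (q + 1) := div_pos (by linarith) hq1
      have h1 := h _ hl
      have h2 : -a / (q + 1) * (q + 1) = -a := div_mul_cancel₀ _ hq1.ne'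
      rw [← hp0, zero_mul] at h1
      linarith
    · have h1 := h (p / q') (by positivity)
      have h2 : p / q' * q ≤ p := by
        rw [div_mul_eq_mul_div, div_le_iff₀ hq'pos]
        exact mul_le_mul_of_nonneg_left hqq hp
      have h3 : q' * (p / q' * Real.log (p / q')) = p * Real.log (p / q') := by
        field_simp
      linarith

/-- `exists_log_tangent` at each effect `M x`, optimised over `l` by `klSummand_le`, bounds the
summand by `A (M x) + tr (ρ M x)`. These bounds add up to `A 1 + tr ρ = tr (ρ log τ)` for every
POVM. -/
lemma measuredEntropy_le_logTrace {ρ τ σ : Matrix n n ℂ} (hρ : IsDensityOperator ρ)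
    (hτ : τ.PosDef) (hσ : (σ - fderivLog τ ρ).PosSemidef) :
    measuredEntropy ρ σ ≤ (logTrace ρ τ : EReal) := by
  obtain ⟨A, hA1, hA⟩ := exists_log_tangent hτ hρ.1
  refine iSup₂_le fun k M => ?_
  have hle : ∀ x, klSummand (M.prob ρ x) (M.prob σ x)
      ≤ ((A (M.op x) + M.prob ρ x : ℝ) : EReal) := by
    intro x
    refine klSummand_le (q := (fderivLog τ ρ * M.op x).trace.re)
      (re_trace_mul_nonneg hρ.1 (M.posSemidef x))
      (re_trace_fderivLog_mul_nonneg hτ hρ.1 (M.posSemidef x)) ?_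
      (hA _ (M.posSemidef x))
    have := re_trace_mul_nonneg hσ (M.posSemidef x)
    rw [Matrix.sub_mul, trace_sub, Complex.sub_re] at this
    simpa [POVM.prob] using this
  refine (Finset.sum_le_sum fun x _ => hle x).trans ?_
  rw [← EReal.coe_finsetSum]
  refine EReal.coe_le_coe_iff.mpr (le_of_eq ?_)
  have hp : ∑ x, M.prob ρ x = ρ.trace.re := by
    simp only [POVM.prob]
    rw [← Complex.re_sum, ← trace_sum, ← Matrix.mul_sum, M.sum_eq_one, Matrix.mul_one]
  rw [Finset.sum_add_distrib, ← map_sum, M.sum_eq_one, hA1, hp, logTrace]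
  ring

/-- The measurement in the basis of columns of a unitary matrix. -/
noncomputable def columnPOVM (U : unitaryGroup n ℂ) : POVM n (Fin (Fintype.card n)) where
  op x := columnProj U ((Fintype.equivFin n).symm x)
  posSemidef _ := columnProj_posSemidef U _
  sum_eq_one := by rw [Equiv.sum_comp (Fintype.equivFin n).symm (columnProj U), sum_columnProj]

/-- For a kernel eigenvector `u` of `τ`, the vector `ρ u` lies in the range of `τ` and so has no
component along `u`. -/
lemma eigenweight_eq_zero {ρ τ : Matrix n n ℂ} (hτ : τ.IsHermitian)
    (hs : operatorSupport ρ ≤ operatorSupport τ) {i : n} (hi : hτ.eigenvalues i = 0) :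
    inBasis hτ.eigenvectorUnitary ρ i i = 0 := by
  set U := hτ.eigenvectorUnitary
  obtain ⟨z, hz⟩ := hs (LinearMap.mem_range_self ρ.mulVecLin ((U : Matrix n n ℂ) *ᵥ Pi.single i 1))
  simp only [mulVecLin_apply] at hz
  have h1 : inBasis U ρ *ᵥ Pi.single i 1
      = inBasis U τ *ᵥ ((U : Matrix n n ℂ)ᴴ *ᵥ z) := by
    simp only [inBasis, ← mulVec_mulVec]
    rw [← hz, mulVec_mulVec z (U : Matrix n n ℂ), unitary_mul_conjTranspose, one_mulVec]
  have hd : inBasis U τ = diagonal fun i => (hτ.eigenvalues i : ℂ) := by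
    rw [← inBasis_conjDiag, ← eq_conjDiag hτ]
  have h2 := congrFun h1 i
  rw [hd, mulVec_diagonal, hi] at h2
  simpa using h2

/-- A zero diagonal entry of a positive semidefinite matrix forces its row to vanish, so `ρ` factors
as `τ` times its pseudo-inverse times `ρ`. -/
lemma operatorSupport_le_of_eigenweight {ρ τ : Matrix n n ℂ} (hρ : ρ.PosSemidef)
    (hτ : τ.IsHermitian)
    (h : ∀ i, hτ.eigenvalues i = 0 → (inBasis hτ.eigenvectorUnitary ρ i i).re = 0) :
    operatorSupport ρ ≤ operatorSupport τ := by
  set U := hτ.eigenvectorUnitary with hU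
  have hP := inBasis_posSemidef U hρ
  have hrow : ∀ i j, hτ.eigenvalues i = 0 → inBasis U ρ i j = 0 := by
    intro i j hi
    have h0 : inBasis U ρ i i = 0 :=
      Complex.ext (h i hi) (Complex.le_def.mp hP.diag_nonneg).2.symm
    have h1 := (hP.dotProduct_mulVec_zero_iff (Pi.single i 1)).mp (by simp [h0])
    have h2 := congrFun h1 j
    rw [← hP.1.apply i j]
    simpa using h2
  have hfac : inBasis U ρ = diagonal (fun i => (hτ.eigenvalues i : ℂ)) *
      (diagonal (fun i => (hτ.eigenvalues i : ℂ)⁻¹) * inBasis U ρ) := by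
    ext i j
    rw [diagonal_mul, diagonal_mul]
    by_cases hi : hτ.eigenvalues i = 0
    · rw [hrow i j hi]; simp
    · rw [mul_inv_cancel_left₀]
      exact_mod_cast hi
  have hfac2 : ρ = τ * ((U : Matrix n n ℂ) * (diagonal (fun i => (hτ.eigenvalues i : ℂ)⁻¹) *
      inBasis U ρ) * (U : Matrix n n ℂ)ᴴ) := by
    nth_rw 1 [← conj_inBasis U ρ]
    have hd : (U : Matrix n n ℂ)ᴴ * (τ * (U : Matrix n n ℂ))
        = diagonal fun i => (hτ.eigenvalues i : ℂ) := by
      rw [← Matrix.mul_assoc, ← inBasis_conjDiag, ← eq_conjDiag hτ, inBasis]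
    nth_rw 1 [hfac]
    rw [← hd]
    simp only [Matrix.mul_assoc]
    rw [← Matrix.mul_assoc (U : Matrix n n ℂ) (U : Matrix n n ℂ)ᴴ, unitary_mul_conjTranspose,
      Matrix.one_mul]
  rintro _ ⟨v, rfl⟩
  refine ⟨((U : Matrix n n ℂ) * (diagonal (fun i => (hτ.eigenvalues i : ℂ)⁻¹) *
      inBasis U ρ) * (U : Matrix n n ℂ)ᴴ) *ᵥ v, ?_⟩
  simp only [mulVecLin_apply]
  rw [mulVec_mulVec, ← hfac2]

/-- This is `log x ≤ x - 1` at `x = q t / w`. The hypothesis `h0` is needed because `Real.log 0 =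
0`. -/
lemma log_div_le {w q t : ℝ} (hw : 0 ≤ w) (hq : 0 < q) (ht : 0 ≤ t) (h0 : t = 0 → w = 0) :
    w * Real.log t ≤ q * (w / q * Real.log (w / q)) + q * t - w := by
  rcases hw.eq_or_lt with rfl | hw
  · simp; positivity
  · have ht : 0 < t := lt_of_le_of_ne ht fun h => hw.ne' (h0 h.symm)
    have h1 := Real.log_le_sub_one_of_pos (x := q * t / w) (by positivity)
    rw [Real.log_div (by positivity) hw.ne', Real.log_mul hq.ne' ht.ne'] at h1
    rw [Real.log_div hw.ne' hq.ne']
    have h2 := mul_le_mul_of_nonneg_left h1 hw.le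
    have h3 : w * (q * t / w - 1) = q * t - w := by field_simp
    have h4 : q * (w / q * (Real.log w - Real.log q)) = w * (Real.log w - Real.log q) := by
      field_simp
    rw [h3] at h2
    rw [h4]
    linarith

lemma logTrace_le_measuredEntropy {ρ τ σ : Matrix n n ℂ} (hρ : IsDensityOperator ρ)
    (hτ : τ.PosSemidef) (hs : operatorSupport ρ ≤ operatorSupport τ) (hσ : σ.PosDef)
    (hστ : (σ * τ).trace.re ≤ 1) :
    (logTrace ρ τ : EReal) ≤ measuredEntropy ρ σ := by
  set U := hτ.1.eigenvectorUnitary with hU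
  refine le_trans ?_ (le_iSup₂ (Fintype.card n) (columnPOVM U))
  have hq : ∀ i, 0 < (inBasis U σ i i).re := by
    intro i
    have hpd : (inBasis U σ).PosDef := by
      refine hσ.conjTranspose_mul_mul_same ?_
      refine Function.LeftInverse.injective (g := fun v => (U : Matrix n n ℂ)ᴴ *ᵥ v) fun v => ?_
      simp only [mulVec_mulVec, conjTranspose_mul_unitary, one_mulVec]
    exact (Complex.lt_def.mp hpd.diag_pos).1
  have hkl : klDivergence ((columnPOVM U).prob ρ) ((columnPOVM U).prob σ)
      = ∑ i, klSummand (inBasis U ρ i i).re (inBasis U σ i i).re := by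
    simp only [klDivergence, POVM.prob, columnPOVM, re_trace_mul_columnProj]
    exact Equiv.sum_comp (Fintype.equivFin n).symm
      fun i => klSummand (inBasis U ρ i i).re (inBasis U σ i i).re
  rw [hkl]
  simp only [klSummand, (hq _).ne', if_false]
  rw [← EReal.coe_finsetSum]
  refine EReal.coe_le_coe_iff.mpr ?_
  have h := Finset.sum_le_sum fun (i : n) (_ : i ∈ Finset.univ) =>
    log_div_le (re_inBasis_nonneg U hρ.1 i) (hq i) (hτ.eigenvalues_nonneg i)
      (fun hi => by rw [eigenweight_eq_zero hτ.1 hs hi, Complex.zero_re])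
  rw [Finset.sum_sub_distrib, Finset.sum_add_distrib, sum_re_inBasis, hρ.2, Complex.one_re] at h
  have h2 := re_trace_mul_conjDiag U σ hτ.1.eigenvalues
  rw [← eq_conjDiag hτ.1] at h2
  rw [logTrace, re_trace_mul_cfc hτ.1]
  linarith

lemma logTrace_add_smul_one {ρ τ : Matrix n n ℂ} (hτ : τ.IsHermitian) (ε : ℝ) :
    logTrace ρ (τ + ε • (1 : Matrix n n ℂ)) =
      ∑ i, (inBasis hτ.eigenvectorUnitary ρ i i).re * Real.log (hτ.eigenvalues i + ε) := by
  have h : τ + ε • (1 : Matrix n n ℂ) = cfc (fun x : ℝ => x + ε) τ := by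
    rw [cfc_eq_conjDiag hτ, ← conjDiag_add, ← eq_conjDiag hτ,
      ← conjDiag_one hτ.eigenvectorUnitary, smul_conjDiag]
    simp
  rw [logTrace, h, ← cfc_comp Real.log (fun x : ℝ => x + ε) τ hτ.isSelfAdjoint
    ((finite_real_spectrum.image _).continuousOn _) (finite_real_spectrum.continuousOn _),
    re_trace_mul_cfc hτ]
  rfl

lemma logTrace_add_smul_one_mono {ρ τ : Matrix n n ℂ} (hρ : ρ.PosSemidef) (hτ : τ.PosSemidef)
    {δ ε : ℝ} (hδ : 0 < δ) (h : δ ≤ ε) :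
    logTrace ρ (τ + δ • (1 : Matrix n n ℂ)) ≤ logTrace ρ (τ + ε • (1 : Matrix n n ℂ)) := by
  rw [logTrace_add_smul_one hτ.1, logTrace_add_smul_one hτ.1]
  refine Finset.sum_le_sum fun i _ => mul_le_mul_of_nonneg_left ?_ (re_inBasis_nonneg _ hρ i)
  have := hτ.eigenvalues_nonneg i
  exact Real.log_le_log (by positivity) (by linarith)

/-- As `ε → 0⁺`, the regularised value tends to `logTrace ρ τ` under the support condition.
Otherwise an eigenvalue `0` of `τ` carries positive weight and drives it to `-∞`. -/
lemma exists_logTrace_add_smul_one_lt {ρ τ : Matrix n n ℂ} (hρ : ρ.PosSemidef)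
    (hτ : τ.PosSemidef) {r : ℝ}
    (hr : operatorSupport ρ ≤ operatorSupport τ → logTrace ρ τ < r) :
    ∃ ε : ℝ, 0 < ε ∧ logTrace ρ (τ + ε • (1 : Matrix n n ℂ)) < r := by
  set U := hτ.1.eigenvectorUnitary with hU
  set t := hτ.1.eigenvalues with ht
  set w : n → ℝ := fun i => (inBasis U ρ i i).re with hw
  have hw0 : ∀ i, 0 ≤ w i := re_inBasis_nonneg U hρ
  have ht0 : ∀ i, 0 ≤ t i := hτ.eigenvalues_nonneg
  have hlog : ∀ ε : ℝ, logTrace ρ (τ + ε • (1 : Matrix n n ℂ)) = ∑ i, w i * Real.log (t i + ε) :=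
    logTrace_add_smul_one hτ.1
  have hne : (𝓝[>] (0 : ℝ)).NeBot := inferInstance
  suffices hev : ∀ᶠ ε in 𝓝[>] (0 : ℝ), ∑ i, w i * Real.log (t i + ε) < r by
    obtain ⟨ε, h1, h2⟩ := (hev.and self_mem_nhdsWithin).exists
    exact ⟨ε, h2, (hlog ε).trans_lt h1⟩
  have hid : ∀ i, Tendsto (fun ε : ℝ => t i + ε) (𝓝[>] 0) (𝓝 (t i)) := fun i => by
    have : Continuous fun ε : ℝ => t i + ε := by fun_prop
    simpa using (this.tendsto 0).mono_left nhdsWithin_le_nhds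
  by_cases hs : ∀ i, t i = 0 → w i = 0
  · have hlt := hr (operatorSupport_le_of_eigenweight hρ hτ.1 hs)
    rw [logTrace, re_trace_mul_cfc hτ.1] at hlt
    refine Tendsto.eventually_lt_const hlt (tendsto_finsetSum _ fun i _ => ?_)
    by_cases hi : t i = 0
    · simp only [hs i hi, zero_mul]
      have : (inBasis hτ.1.eigenvectorUnitary ρ i i).re = 0 := hs i hi
      rw [this, zero_mul]
      exact tendsto_const_nhds
    · exact ((Real.continuousAt_log hi).tendsto.comp (hid i)).const_mul _
  · push Not at hs
    obtain ⟨i, hi, hwi⟩ := hs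
    have hwi : 0 < w i := lt_of_le_of_ne (hw0 i) (Ne.symm hwi)
    set B := ∑ j ∈ Finset.univ.erase i, w j * Real.log (t j + 1) with hB
    have hbot : Tendsto (fun ε : ℝ => w i * Real.log (t i + ε)) (𝓝[>] 0) atBot := by
      simp only [hi, zero_add]
      exact Real.tendsto_log_nhdsGT_zero.const_mul_atBot hwi
    filter_upwards [hbot.eventually_lt_atBot (r - B), self_mem_nhdsWithin,
      nhdsWithin_le_nhds (Iio_mem_nhds one_pos)] with ε h1 h2 h3
    have h2 : 0 < ε := h2
    have h3 : ε < 1 := h3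
    rw [← Finset.add_sum_erase _ _ (Finset.mem_univ i)]
    have : ∑ j ∈ Finset.univ.erase i, w j * Real.log (t j + ε) ≤ B := by
      refine Finset.sum_le_sum fun j _ => mul_le_mul_of_nonneg_left ?_ (hw0 j)
      have := ht0 j
      exact Real.log_le_log (by positivity) (by linarith)
    linarith

lemma exists_forall_logTrace_add_smul_one_lt {ρ : Matrix n n ℂ} (hρ : ρ.PosSemidef)
    {C : Set (Matrix n n ℂ)} (hpos : ∀ τ ∈ C, τ.PosSemidef) (hcomp : IsCompact C) {r : ℝ}
    (hr : ∀ τ ∈ C, operatorSupport ρ ≤ operatorSupport τ → logTrace ρ τ < r) :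
    ∃ ε : ℝ, 0 < ε ∧ ∀ τ ∈ C, logTrace ρ (τ + ε • (1 : Matrix n n ℂ)) < r := by
  -- The repeated membership survives when compactness induction replaces the first `C` by arbitrary
  -- sets, since positivity is known only on `C`. Monotonicity in `ε` lets a union use the smaller
  -- of two values.
  have key : ∃ ε : ℝ, 0 < ε ∧ ∀ τ ∈ C, τ ∈ C → logTrace ρ (τ + ε • (1 : Matrix n n ℂ)) < r := by
    refine hcomp.induction_on (p := fun S => ∃ ε : ℝ, 0 < ε ∧ ∀ τ ∈ S, τ ∈ C →
      logTrace ρ (τ + ε • (1 : Matrix n n ℂ)) < r) ⟨1, one_pos, by simp⟩ ?_ ?_ ?_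
    · rintro s t hst ⟨ε, h1, h2⟩
      exact ⟨ε, h1, fun τ hτ => h2 τ (hst hτ)⟩
    · rintro s t ⟨ε, h1, h2⟩ ⟨δ, h3, h4⟩
      refine ⟨min ε δ, lt_min h1 h3, ?_⟩
      rintro τ (hτ | hτ) hC
      · exact (logTrace_add_smul_one_mono hρ (hpos τ hC) (lt_min h1 h3)
          (min_le_left _ _)).trans_lt (h2 τ hτ hC)
      · exact (logTrace_add_smul_one_mono hρ (hpos τ hC) (lt_min h1 h3)
          (min_le_right _ _)).trans_lt (h4 τ hτ hC)
    · intro τ hτ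
      obtain ⟨ε, hε, hlt⟩ := exists_logTrace_add_smul_one_lt hρ (hpos τ hτ) (hr τ hτ)
      have hc : ContinuousOn (fun ω : Matrix n n ℂ => logTrace ρ (ω + ε • (1 : Matrix n n ℂ))) C :=
        (continuousOn_logTrace hρ hε).comp (continuous_id.add continuous_const).continuousOn
          fun ω hω => by simpa using hpos ω hω
      exact ⟨_, (hc τ hτ).eventually_lt_const hlt, ε, hε, fun ω hω _ => hω⟩
  obtain ⟨ε, h1, h2⟩ := key
  exact ⟨ε, h1, fun τ hτ => h2 τ hτ hτ⟩

end Entropy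

/-! ### Construction of nearly optimal polar elements and the duality identity. -/

section Duality
variable {n : Type*} [Fintype n] [DecidableEq n]

lemma fderivLog_posSemidef {τ ρ : Matrix n n ℂ} (hτ : τ.PosDef) (hρ : ρ.PosSemidef) :
    (fderivLog τ ρ).PosSemidef := by
  have hH := fderivLog_isHermitian hτ hρ.1
  refine PosSemidef.of_dotProduct_mulVec_nonneg hH fun v => ?_
  have h1 := re_trace_fderivLog_mul_nonneg hτ hρ (posSemidef_vecMulVec_self_star v)
  rw [mul_vecMulVec, trace_vecMulVec, dotProduct_comm] at h1
  exact Complex.le_def.mpr ⟨h1, (hH.im_star_dotProduct_mulVec_self v).symm⟩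

lemma re_trace_fderivLog_pos {τ ρ : Matrix n n ℂ} (hτ : τ.PosDef) (hρ : IsDensityOperator ρ) :
    0 < (fderivLog τ ρ).trace.re := by
  rw [re_trace_fderivLog hτ]
  have hw := re_inBasis_nonneg hτ.1.eigenvectorUnitary hρ.1
  have hsum := sum_re_inBasis hτ.1.eigenvectorUnitary ρ
  rw [hρ.2, Complex.one_re] at hsum
  have ht := fun i => inv_pos.mpr (hτ.eigenvalues_pos i)
  obtain ⟨i, hi, hpos⟩ := Finset.exists_lt_of_sum_lt (s := Finset.univ) (f := fun _ : n => (0 : ℝ))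
    (g := fun i => (inBasis hτ.1.eigenvectorUnitary ρ i i).re) (by simp [hsum])
  exact Finset.sum_pos' (fun i _ => mul_nonneg (hw i) (ht i).le) ⟨i, hi, mul_pos hpos (ht i)⟩

lemma exists_polar_measuredEntropy_le_of_nonempty {ρ : Matrix n n ℂ} (hρ : IsDensityOperator ρ)
    {C : Set (Matrix n n ℂ)} (hne : C.Nonempty) (hpos : ∀ τ ∈ C, τ.PosSemidef)
    (hconv : Convex ℝ C) (hcomp : IsCompact C) {r : ℝ}
    (hr : ∀ τ ∈ C, operatorSupport ρ ≤ operatorSupport τ → logTrace ρ τ < r) :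
    ∃ σ ∈ polarSetPosDef C, measuredEntropy ρ σ ≤ (r : EReal) := by
  obtain ⟨ε, hε, hlt⟩ := exists_forall_logTrace_add_smul_one_lt hρ.1 hpos hcomp hr
  have hcomp' : IsCompact ((fun τ : Matrix n n ℂ => ε • (1 : Matrix n n ℂ) + τ) '' C) :=
    hcomp.image (continuous_const.add continuous_id)
  obtain ⟨_, ⟨τ, hτ, rfl⟩, hpolar⟩ := exists_fderivLog_mem_polar hρ (hne.image _) hcomp'
    (hconv.translate _) hε (by rintro _ ⟨τ, hτ, rfl⟩; simpa using hpos τ hτ)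
  simp only [forall_mem_image] at hpolar
  have hpd : (ε • (1 : Matrix n n ℂ) + τ).PosDef := (PosDef.one.smul hε).add_posSemidef (hpos τ hτ)
  set S := fderivLog (ε • (1 : Matrix n n ℂ) + τ) ρ with hS
  have hSpos : S.PosSemidef := fderivLog_posSemidef hpd hρ.1
  have htr : 0 < S.trace.re := re_trace_fderivLog_pos hpd hρ
  have hcont : Continuous fun X : Matrix n n ℂ => X.trace.re :=
    Complex.continuous_re.comp continuous_id.matrix_trace
  obtain ⟨ω, hω, hmax⟩ := hcomp.exists_isMaxOn hne hcont.continuousOn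
  have hB : 0 ≤ ω.trace.re := (Complex.le_def.mp (hpos ω hω).trace_nonneg).1
  -- Polarity on the shifted set gives `tr (S Y) ≤ 1 - ε tr S` on `C`. This `η` keeps `η tr Y`
  -- within the slack `ε tr S`, as `ω` has maximal trace; the `+ 1` keeps the denominator positive.
  set η := ε * S.trace.re / (ω.trace.re + 1) with hη
  have hη0 : 0 < η := by positivity
  have hηB : η * (ω.trace.re + 1) = ε * S.trace.re := div_mul_cancel₀ _ (by positivity)
  have hσ : (S + η • (1 : Matrix n n ℂ)).PosDef := PosDef.posSemidef_add hSpos (PosDef.one.smul hη0)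
  refine ⟨S + η • (1 : Matrix n n ℂ), ⟨⟨hσ.1, fun Y hY => ?_⟩, hσ⟩, ?_⟩
  · have h1 := hpolar hY
    have h2 : Y.trace.re ≤ ω.trace.re := hmax hY
    simp only [Matrix.mul_add, Matrix.add_mul, trace_add, Complex.add_re, Matrix.mul_smul,
      Matrix.smul_mul, Matrix.mul_one, Matrix.one_mul, trace_smul, Complex.smul_re,
      smul_eq_mul] at h1 ⊢
    have h3 := mul_le_mul_of_nonneg_left h2 hη0.le
    linarith
  · refine (measuredEntropy_le_logTrace hρ hpd ?_).trans (EReal.coe_le_coe_iff.mpr ?_)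
    · rw [← hS, add_sub_cancel_left]
      exact PosSemidef.one.smul hη0.le
    · rw [add_comm]
      exact (hlt τ hτ).le

lemma logTrace_smul_one {ρ : Matrix n n ℂ} (hρ : IsDensityOperator ρ) (c : ℝ) :
    logTrace ρ (c • (1 : Matrix n n ℂ)) = Real.log c := by
  rw [← Algebra.algebraMap_eq_smul_one, logTrace, cfc_algebraMap, Algebra.algebraMap_eq_smul_one,
    Matrix.mul_smul, Matrix.mul_one, trace_smul, hρ.2]
  simp

lemma exists_polar_measuredEntropy_le {ρ : Matrix n n ℂ} (hρ : IsDensityOperator ρ)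
    {C : Set (Matrix n n ℂ)} (hpos : ∀ τ ∈ C, τ.PosSemidef)
    (hconv : Convex ℝ C) (hcomp : IsCompact C) {r : ℝ}
    (hr : ∀ τ ∈ C, operatorSupport ρ ≤ operatorSupport τ → logTrace ρ τ < r) :
    ∃ σ ∈ polarSetPosDef C, measuredEntropy ρ σ ≤ (r : EReal) := by
  rcases C.eq_empty_or_nonempty with rfl | hne
  · obtain ⟨σ, hσ, hle⟩ := exists_polar_measuredEntropy_le_of_nonempty hρ
      -- For empty `C`, a singleton is substituted whose `logTrace` value is `r - 1 < r`; polarity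
      -- to the empty set is vacuous.
      (C := {Real.exp (r - 1) • (1 : Matrix n n ℂ)}) (singleton_nonempty _)
      (by rintro _ rfl; exact PosSemidef.one.smul (Real.exp_pos _).le)
      (convex_singleton _) isCompact_singleton (r := r) (by
        rintro _ rfl _
        rw [logTrace_smul_one hρ, Real.log_exp]
        linarith)
    exact ⟨σ, ⟨⟨hσ.1.1, by simp⟩, hσ.2⟩, hle⟩
  · exact exists_polar_measuredEntropy_le_of_nonempty hρ hne hpos hconv hcomp hr

lemma logTrace_le_re_trace_mul {ρ τ : Matrix n n ℂ} (hρ : ρ.PosSemidef) (hτ : τ.PosSemidef) :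
    logTrace ρ τ ≤ (ρ * τ).trace.re := by
  have h := re_trace_mul_conjDiag hτ.1.eigenvectorUnitary ρ hτ.1.eigenvalues
  rw [← eq_conjDiag hτ.1] at h
  rw [logTrace, re_trace_mul_cfc hτ.1, h]
  exact Finset.sum_le_sum fun i _ => mul_le_mul_of_nonneg_left
    (Real.log_le_self (hτ.eigenvalues_nonneg i)) (re_inBasis_nonneg _ hρ i)

lemma umegakiEntropy_one (ρ : Matrix n n ℂ) :
    umegakiEntropy ρ 1 = (logTrace ρ ρ : EReal) := by
  have h1 : operatorSupport (1 : Matrix n n ℂ) = ⊤ := by simp [operatorSupport]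
  rw [umegakiEntropy, if_pos (h1 ▸ le_top), cfc_apply_one]
  simp [logTrace]

/-- This excludes the sum `⊥ + ⊤` from the additive form of the identity. Since `log t ≤ t`,
`logTrace` is bounded above on the compact set `C`. -/
lemma divergenceToSet_measured_ne_top {ρ : Matrix n n ℂ} (hρ : IsDensityOperator ρ)
    {C : Set (Matrix n n ℂ)} (hpos : ∀ τ ∈ C, τ.PosSemidef)
    (hconv : Convex ℝ C) (hcomp : IsCompact C) :
    divergenceToSet measuredEntropy ρ (polarSetPosDef C) ≠ ⊤ := by
  have hcont : Continuous fun X : Matrix n n ℂ => (ρ * X).trace.re :=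
    Complex.continuous_re.comp (continuous_const.matrix_mul continuous_id).matrix_trace
  obtain ⟨B, hB⟩ := (hcomp.image hcont).bddAbove
  obtain ⟨σ, hσ, hle⟩ := exists_polar_measuredEntropy_le hρ hpos hconv hcomp (r := B + 1)
    fun τ hτ _ => by
      have h1 := logTrace_le_re_trace_mul hρ.1 (hpos τ hτ)
      have h2 := hB (mem_image_of_mem _ hτ)
      linarith
  exact (((iInf₂_le σ hσ).trans hle).trans_lt (EReal.coe_lt_top _)).ne

lemma divergenceToSet_umegaki_eq_sub {ρ : Matrix n n ℂ} (hρ : IsDensityOperator ρ)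
    {C : Set (Matrix n n ℂ)} (hpos : ∀ τ ∈ C, τ.PosSemidef)
    (hconv : Convex ℝ C) (hcomp : IsCompact C) :
    divergenceToSet umegakiEntropy ρ C
      = (logTrace ρ ρ : EReal) - divergenceToSet measuredEntropy ρ (polarSetPosDef C) := by
  refine le_antisymm ?_ (le_iInf₂ fun τ hτ => ?_)
  · by_contra! hlt
    -- A real `r` strictly below the infimum gives the strict bound `logTrace ρ τ < logTrace ρ ρ -
    -- r` required to construct a polar element.
    obtain ⟨r, h1, h2⟩ := EReal.lt_iff_exists_real_btwn.mp hlt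
    obtain ⟨σ, hσ, hle⟩ := exists_polar_measuredEntropy_le hρ hpos hconv hcomp
      (r := logTrace ρ ρ - r) fun τ hτ hs => by
        have h3 := h2.trans_le (iInf₂_le τ hτ)
        rw [umegakiEntropy, if_pos hs] at h3
        have h4 : r < logTrace ρ ρ - logTrace ρ τ := EReal.coe_lt_coe_iff.mp h3
        linarith
    have h5 : divergenceToSet measuredEntropy ρ (polarSetPosDef C)
        ≤ ((logTrace ρ ρ - r : ℝ) : EReal) := (iInf₂_le σ hσ).trans hle
    have h6 := EReal.sub_le_sub (le_refl (logTrace ρ ρ : EReal)) h5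
    rw [← EReal.coe_sub, sub_sub_cancel] at h6
    exact absurd h1 (not_lt.mpr h6)
  · by_cases hs : operatorSupport ρ ≤ operatorSupport τ
    · have h1 : (logTrace ρ τ : EReal) ≤ divergenceToSet measuredEntropy ρ (polarSetPosDef C) :=
        le_iInf₂ fun σ hσ => logTrace_le_measuredEntropy hρ (hpos τ hτ) hs hσ.2 (hσ.1.2 τ hτ)
      rw [umegakiEntropy, if_pos hs, EReal.coe_sub]
      exact EReal.sub_le_sub le_rfl h1
    · rw [umegakiEntropy, if_neg hs]
      exact le_top

end Duality

end

theorem proposition2 {n : Type*} [Fintype n] [DecidableEq n]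
    (ρ : Matrix n n ℂ) (hρ : IsDensityOperator ρ)
    (C : Set (Matrix n n ℂ)) (hCpos : ∀ σ ∈ C, σ.PosSemidef)
    (hCconv : Convex ℝ C) (hCcomp : IsCompact C) :
    (divergenceToSet umegakiEntropy ρ C ≠ ⊤ →
      divergenceToSet umegakiEntropy ρ C + divergenceToSet measuredEntropy ρ (polarSetPosDef C)
        = umegakiEntropy ρ 1) ∧
    divergenceToSet umegakiEntropy ρ C
      = umegakiEntropy ρ 1 - divergenceToSet measuredEntropy ρ (polarSetPosDef C) := by
  have h := divergenceToSet_umegaki_eq_sub hρ hCpos hCconv hCcomp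
  have htop := divergenceToSet_measured_ne_top hρ hCpos hCconv hCcomp
  rw [umegakiEntropy_one]
  refine ⟨fun hD => ?_, h⟩
  rw [h] at hD ⊢
  -- The value `⊥` would make the Umegaki divergence `⊤`, against `hD`; only real values remain,
  -- where the subtraction can be undone.
  generalize divergenceToSet measuredEntropy ρ (polarSetPosDef C) = x at hD htop ⊢
  induction x with
  | bot => simp at hD
  | top => exact absurd rfl htop
  | coe x => norm_cast; ring_nf
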